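/- Theorem 3.7. For a set $\Omega$ in a Euclidean space and $z\in\Omega$ let $T(z;\Omega)=\{w\mid \exists\, z_k\to z,\ z_k\in\Omega,\ \alpha_k\ge 0 \text{ with } \alpha_k(z_k-z)\to w\}$ be the tangent cone, $\widehat N(z;\Omega)=\{v\mid \limsup_{u\to z,\,u\in\Omega\setminus\{z\}}\langle v,u-z\rangle/\|u-z\|\le 0\}$ the regular normal cone, and $N(z;\Omega)$ the limiting normal cone, i.e. the set of limits of sequences $v_k\in\widehat N(z_k;\Omega)$ with $z_k\in\Omega$, $z_k\to z$. For a set-valued mapping $F\colon\mathbb R^m\rightrightarrows\mathbb R^m$ with $\operatorname{dom}F=\{x\mid F(x)\neq\emptyset\}$, $\operatorname{gph}F=\{(x,y)\mid y\in F(x)\}$ and $(x,y)\in\operatorname{gph}F$, the graphical derivative and the regular coderivative are $$DF(x,y)(u)=\{w\mid (u,w)\in T((x,y);\operatorname{gph}F)\},\qquad \widehat D^*F(x,y)(v)=\{u\mid (u,-v)\in\widehat N((x,y);\operatorname{gph}F)\}.$$ Let $\theta\colon\mathbb R^m\to(-\infty,\infty]$ be convex piecewise linear ($\theta\in CPWL$),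 that is, a proper function whose epigraph $\operatorname{epi}\theta=\{(z,r)\in\mathbb R^m\times\mathbb R\mid\theta(z)\le r\}$ is a convex polyhedron. Let $\operatorname{dom}\theta=\{z\mid\theta(z)<\infty\}$, and let $\partial\theta(z)=\{v\mid (v,-1)\in N((z,\theta(z));\operatorname{epi}\theta)\}$ for $z\in\operatorname{dom}\theta$ and $\partial\theta(z)=\emptyset$ otherwise. Let $(\bar z,\bar v)\in\operatorname{gph}\partial\theta$, and define the critical cone $$\mathcal K(\bar z,\bar v)=\{w\in T(\bar z;\operatorname{dom}\theta)\mid \langle\bar v,w\rangle=d\theta(\bar z)(w)\},\qquad d\theta(\bar z)(w)=\liminf_{u\to w,\ t\downarrow 0}\frac{\theta(\bar z+tu)-\theta(\bar z)}{t}.$$ Then $$\operatorname{dom}\,(D\partial\theta)(\bar z,\bar v)=-\operatorname{dom}\,(\widehat D^*\partial\theta)(\bar z,\bar v)=\mathcal K(\bar z,\bar v).$$ Moreover, for every $u\in\mathcal K(\bar z,\bar v)$, $$(D\partial\theta)(\bar z,\bar v)(u)=\big\{w\in(\widehat D^*\partial\theta)(\bar z,\bar v)(-u)\mid\langle w,u\rangle=0\big\}=\operatorname{argmin}\big\{-\langle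 w,u\rangle\mid w\in(\widehat D^*\partial\theta)(\bar z,\bar v)(-u)\big\}.$$ -/

import Mathlib

open Set Filter Topology
open scoped NNReal Pointwise

/-! The product of two inner product spaces is `WithLp 2 (X × Y)`, whose inner product is
`⟪x, x'⟫ + ⟪y, y'⟫`; pairs are built with `WithLp.toLp 2 (x, y)`. -/

namespace VarAnalysis

section Cones

variable {H : Type*} [NormedAddCommGroup H] [InnerProductSpace ℝ H]

/-- The Bouligand-Severi tangent cone `T(z; Ω)`: all limits of `α k • (z k - z)` with `α k ≥ 0`,
`z k ∈ Ω` and `z k → z`. -/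
def tangentCone (Ω : Set H) (z : H) : Set H :=
  {w | ∃ (y : ℕ → H) (α : ℕ → ℝ), (∀ k, y k ∈ Ω) ∧ (∀ k, 0 ≤ α k) ∧
    Tendsto y atTop (𝓝 z) ∧ Tendsto (fun k => α k • (y k - z)) atTop (𝓝 w)}

/-- The tangent cone above agrees with Mathlib's `posTangentConeAt`. -/
theorem tangentCone_eq_posTangentConeAt (Ω : Set H) (z : H) :
    tangentCone Ω z = posTangentConeAt Ω z := by
  ext w
  rw [mem_tangentConeAt_iff_exists_seq]
  constructor
  · rintro ⟨y, α, hy, hα, hyz, hw⟩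
    refine ⟨fun k => ⟨α k, hα k⟩, fun k => y k - z, ?_, ?_, ?_⟩
    · simpa using hyz.sub_const z
    · exact Eventually.of_forall fun k => by simpa using hy k
    · exact hw
  · rintro ⟨c, d, hd, hΩ, hw⟩
    obtain ⟨N, hN⟩ := eventually_atTop.1 hΩ
    refine ⟨fun k => z + d (k + N), fun k => (c (k + N) : ℝ), fun k => hN _ (by omega),
      fun k => (c (k + N)).2, ?_, ?_⟩
    · simpa using ((tendsto_add_atTop_iff_nat N).2 hd).const_add z
    · simpa [NNReal.smul_def] using (tendsto_add_atTop_iff_nat N).2 hw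

/-- The Fréchet (regular) normal cone to `Ω` at `z ∈ Ω`:
`limsup ⟪v, u - z⟫ / ‖u - z‖ ≤ 0` as `u → z`, `u ∈ Ω`, `u ≠ z` (computed in `[-∞, ∞]`). -/
noncomputable def regularNormalCone (Ω : Set H) (z : H) : Set H :=
  {v | limsup (fun u : H => ((inner ℝ v (u - z) / ‖u - z‖ : ℝ) : EReal)) (𝓝[Ω \ {z}] z) ≤ 0}

/-- The Mordukhovich (limiting) normal cone to `Ω` at `z`. -/
noncomputable def limitingNormalCone (Ω : Set H) (z : H) : Set H :=
  {v | ∃ (y : ℕ → H) (n : ℕ → H), (∀ k, y k ∈ Ω) ∧ (∀ k, n k ∈ regularNormalCone Ω (y k)) ∧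
    Tendsto y atTop (𝓝 z) ∧ Tendsto n atTop (𝓝 v)}

/-- A convex polyhedron: the intersection of finitely many closed half-spaces. -/
def IsPolyhedron (S : Set H) : Prop :=
  ∃ (k : ℕ) (a : Fin k → H) (b : Fin k → ℝ), S = {x | ∀ i, inner ℝ (a i) x ≤ b i}

/-- The set of minimizers of `f` over `S`. -/
def argminOn (f : H → ℝ) (S : Set H) : Set H :=
  {w | w ∈ S ∧ IsMinOn f S w}

end Cones

section SetValued

variable {X Y : Type*} [NormedAddCommGroup X] [InnerProductSpace ℝ X]
  [NormedAddCommGroup Y] [InnerProductSpace ℝ Y]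

/-- The domain of a set-valued mapping. -/
def svDom (F : X → Set Y) : Set X := {x | (F x).Nonempty}

/-- The graph of a set-valued mapping. -/
def gph (F : X → Set Y) : Set (WithLp 2 (X × Y)) := {p | p.snd ∈ F p.fst}

/-- The graphical derivative `DF(x, y)`. -/
def graphicalDerivative (F : X → Set Y) (x : X) (y : Y) (u : X) : Set Y :=
  {w | WithLp.toLp 2 (u, w) ∈ tangentCone (gph F) (WithLp.toLp 2 (x, y))}

/-- The regular coderivative `D̂*F(x, y)`. -/
noncomputable def regularCoderivative (F : X → Set Y) (x : X) (y : Y) (v : Y) : Set X :=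
  {u | WithLp.toLp 2 (u, -v) ∈ regularNormalCone (gph F) (WithLp.toLp 2 (x, y))}

end SetValued

section Functions

variable {E : Type*} [NormedAddCommGroup E] [InnerProductSpace ℝ E]

/-- The effective domain of an extended-real-valued function. -/
def effDom (θ : E → EReal) : Set E := {z | θ z < ⊤}

/-- The epigraph, as a subset of `E × ℝ`. -/
def epi (θ : E → EReal) : Set (WithLp 2 (E × ℝ)) := {p | θ p.fst ≤ (p.snd : EReal)}

/-- Convex piecewise linear functions: proper functions `θ : E → (-∞, ∞]` whose epigraph is a
convex polyhedron. -/
structure IsCPWL (θ : E → EReal) : Prop where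
  ne_bot : ∀ z, θ z ≠ ⊥
  effDom_nonempty : (effDom θ).Nonempty
  isPolyhedron_epi : IsPolyhedron (epi θ)

/-- The basic (limiting) subdifferential `∂θ`; it is empty at points where `θ` is not finite. -/
noncomputable def subdifferential (θ : E → EReal) (z : E) : Set E :=
  {v | ∃ r : ℝ, θ z = r ∧
    WithLp.toLp 2 (v, (-1 : ℝ)) ∈ limitingNormalCone (epi θ) (WithLp.toLp 2 (z, r))}

/-- The Dini-Hadamard subderivative
`dθ(z)(w) = liminf (θ (z + t u) - θ z) / t` as `u → w`, `t ↓ 0`. -/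
noncomputable def subderivative (θ : E → EReal) (z w : E) : EReal :=
  liminf (fun p : ℝ × E => (θ (z + p.1 • p.2) - θ z) / (p.1 : EReal)) (𝓝[>] (0 : ℝ) ×ˢ 𝓝 w)

/-- The critical cone `𝒦(z, v)` of `θ`. -/
noncomputable def criticalCone (θ : E → EReal) (z v : E) : Set E :=
  {w | w ∈ tangentCone (effDom θ) z ∧ ((inner ℝ v w : ℝ) : EReal) = subderivative θ z w}

end Functions

end VarAnalysis

namespace VarAnalysis

/-! ### Tangent and normal cones: convex sets and sets that are conical near a point. -/

section Cones

variable {H : Type*} [NormedAddCommGroup H] [InnerProductSpace ℝ H]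

/-! Everything rests on the reduction lemma `eventually_mem_gph_subdifferential_iff`: near `(z, v)`,
the graph of `∂θ` is `(z, v)` plus the graph of the normal cone mapping of the critical cone `K`.
The graph of `N_K` is a closed cone, so it is its own tangent cone, and its polar, the regular
normal cone, is `K° × K`. Hence `w ∈ D∂θ(u)` means `u ∈ K`, `w ∈ K°`, `⟪w, u⟫ = 0`, while `w ∈
D̂*∂θ(-u)` means `u ∈ K`, `w ∈ K°`. The domains follow with `w = 0`, and the argmin formula holds
because `-⟪w, u⟫ ≥ 0` on `K°`, with value `0` at `w = 0`.

For the reduction, the epigraph coincides near `p = (z, θ z)` with `p + T`, `T` the cone of active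
constraints. Then `T` is the epigraph of the subderivative, `(v, -1)` is polar to `T`, and `K`
corresponds to the face of `T` exposed by `(v, -1)`. Since `T` is finitely generated,
`eventually_polar_polyhedralCone` controls the faces exposed by `(v', -1)` for `v'` near `v`. -/

theorem mem_regularNormalCone_iff {Ω : Set H} {z v : H} :
    v ∈ regularNormalCone Ω z ↔
      ∀ ε > 0, ∀ᶠ u in 𝓝 z, u ∈ Ω → inner ℝ v (u - z) ≤ ε * ‖u - z‖ := by
  rw [regularNormalCone, mem_ofPred_eq, limsup_le_iff]
  simp only [eventually_nhdsWithin_iff]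
  constructor
  · intro h ε hε
    filter_upwards [h (ε : EReal) (by exact_mod_cast hε)] with u hu huΩ
    by_cases huz : u = z
    · simp [huz]
    · have h1 := EReal.coe_lt_coe_iff.1 (hu ⟨huΩ, huz⟩)
      rw [div_lt_iff₀ (norm_pos_iff.2 (sub_ne_zero.2 huz))] at h1
      exact h1.le
  · intro h y hy
    obtain ⟨ε, hε, hεy⟩ := EReal.lt_iff_exists_real_btwn.1 hy
    filter_upwards [h ε (by exact_mod_cast hε)] with u hu huΩ
    refine lt_of_le_of_lt (EReal.coe_le_coe_iff.2 ?_) hεy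
    rw [div_le_iff₀ (norm_pos_iff.2 (sub_ne_zero.2 huΩ.2))]
    exact hu huΩ.1

theorem tendsto_add_smul_nhdsGT_zero (z w : H) :
    Tendsto (fun t : ℝ => z + t • w) (𝓝[>] 0) (𝓝 z) := by
  have : Continuous fun t : ℝ => z + t • w := by fun_prop
  simpa using (this.tendsto 0).mono_left nhdsWithin_le_nhds

theorem inner_nonpos_of_mem_regularNormalCone {Ω : Set H} {z v w : H}
    (hv : v ∈ regularNormalCone Ω z) (hw : ∀ᶠ t : ℝ in 𝓝[>] 0, z + t • w ∈ Ω) :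
    inner ℝ v w ≤ 0 := by
  rw [mem_regularNormalCone_iff] at hv
  have key : ∀ ε > 0, inner ℝ v w ≤ ε * ‖w‖ := by
    intro ε hε
    obtain ⟨t, ht, h1, h2⟩ := (((tendsto_add_smul_nhdsGT_zero z w).eventually (hv ε hε)).and
      (hw.and self_mem_nhdsWithin)).exists
    have h2 : 0 < t := h2
    have h3 := ht h1
    rw [add_sub_cancel_left, inner_smul_right, norm_smul, Real.norm_of_nonneg h2.le,
      mul_left_comm] at h3
    exact le_of_mul_le_mul_left h3 h2
  by_contra! hpos
  -- This `ε` makes `ε * ‖w‖` less than half of `inner ℝ v w`.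
  have h1 := key (inner ℝ v w / (2 * (‖w‖ + 1))) (by positivity)
  rw [div_mul_eq_mul_div, le_div_iff₀ (by positivity)] at h1
  nlinarith [norm_nonneg w]

theorem mem_regularNormalCone_of_forall {Ω : Set H} {z v : H}
    (h : ∀ᶠ u in 𝓝 z, u ∈ Ω → inner ℝ v (u - z) ≤ 0) : v ∈ regularNormalCone Ω z := by
  rw [mem_regularNormalCone_iff]
  intro ε hε
  filter_upwards [h] with u hu huΩ
  exact (hu huΩ).trans (by positivity)

/-- Convexity keeps segments inside `Ω`; testing regular normals along them gives an inequality at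
every point of `Ω`, which survives limits. -/
theorem mem_limitingNormalCone_iff_of_convex {Ω : Set H} (hΩ : Convex ℝ Ω) {z v : H}
    (hz : z ∈ Ω) : v ∈ limitingNormalCone Ω z ↔ ∀ u ∈ Ω, inner ℝ v (u - z) ≤ 0 := by
  constructor
  · rintro ⟨y, n, hy, hn, hyz, hnv⟩ u hu
    have hlim : Tendsto (fun k => inner ℝ (n k) (u - y k)) atTop (𝓝 (inner ℝ v (u - z))) :=
      hnv.inner (hyz.const_sub u)
    refine le_of_tendsto' hlim fun k => inner_nonpos_of_mem_regularNormalCone (hn k) ?_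
    filter_upwards [Ioo_mem_nhdsGT (zero_lt_one' ℝ)] with t ht
    exact hΩ.add_smul_sub_mem (hy k) hu ⟨ht.1.le, ht.2.le⟩
  · intro h
    exact ⟨fun _ => z, fun _ => v, fun _ => hz,
      fun _ => mem_regularNormalCone_of_forall (Eventually.of_forall h),
      tendsto_const_nhds, tendsto_const_nhds⟩

theorem eventually_add_smul_mem_of_eventually_iff {Ω G : Set H} {z w : H}
    (hG : ∀ t : ℝ, 0 ≤ t → ∀ w ∈ G, t • w ∈ G) (hΩ : ∀ᶠ u in 𝓝 z, u ∈ Ω ↔ u - z ∈ G)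
    (hw : w ∈ G) : ∀ᶠ t : ℝ in 𝓝[>] 0, z + t • w ∈ Ω := by
  filter_upwards [(tendsto_add_smul_nhdsGT_zero z w).eventually hΩ, self_mem_nhdsWithin]
    with t ht ht0
  rw [ht, add_sub_cancel_left]
  exact hG t (le_of_lt ht0) w hw

theorem mem_regularNormalCone_iff_of_eventually_iff {Ω G : Set H} {z v : H}
    (hG : ∀ t : ℝ, 0 ≤ t → ∀ w ∈ G, t • w ∈ G) (hΩ : ∀ᶠ u in 𝓝 z, u ∈ Ω ↔ u - z ∈ G) :
    v ∈ regularNormalCone Ω z ↔ ∀ w ∈ G, inner ℝ v w ≤ 0 := by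
  constructor
  · intro hv w hw
    exact inner_nonpos_of_mem_regularNormalCone hv
      (eventually_add_smul_mem_of_eventually_iff hG hΩ hw)
  · intro h
    refine mem_regularNormalCone_of_forall ?_
    filter_upwards [hΩ] with u hu huΩ
    exact h _ (hu.1 huΩ)

theorem mem_tangentCone_of_eventually_add_smul_mem {Ω : Set H} {z w : H}
    (h : ∀ᶠ t : ℝ in 𝓝[>] 0, z + t • w ∈ Ω) : w ∈ tangentCone Ω z := by
  obtain ⟨δ, hδ, hδΩ⟩ := mem_nhdsGT_iff_exists_Ioo_subset.1 h
  have hδ : 0 < δ := hδ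
  -- The shift by `2` keeps the step strictly below `δ` already at `k = 0`.
  have htpos : ∀ k : ℕ, 0 < δ / (k + 2) := fun k => by positivity
  have htδ : ∀ k : ℕ, δ / (k + 2) < δ := fun k => by
    rw [div_lt_iff₀ (by positivity)]
    nlinarith [(Nat.cast_nonneg k : (0 : ℝ) ≤ k)]
  have hlim : Tendsto (fun k : ℕ => δ / ((k : ℝ) + 2)) atTop (𝓝[>] 0) :=
    tendsto_nhdsWithin_iff.2 ⟨tendsto_const_nhds.div_atTop
      (tendsto_atTop_add_const_right _ _ tendsto_natCast_atTop_atTop),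
      Eventually.of_forall htpos⟩
  refine ⟨fun k => z + (δ / (k + 2)) • w, fun k => (δ / (k + 2))⁻¹,
    fun k => hδΩ ⟨htpos k, htδ k⟩, fun k => (inv_pos.2 (htpos k)).le,
    (tendsto_add_smul_nhdsGT_zero z w).comp hlim, ?_⟩
  refine tendsto_const_nhds.congr fun k => ?_
  rw [add_sub_cancel_left, inv_smul_smul₀ (htpos k).ne']

theorem tangentCone_eq_of_eventually_iff {Ω G : Set H} {z : H}
    (hG : ∀ t : ℝ, 0 ≤ t → ∀ w ∈ G, t • w ∈ G) (hGc : IsClosed G)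
    (hΩ : ∀ᶠ u in 𝓝 z, u ∈ Ω ↔ u - z ∈ G) : tangentCone Ω z = G := by
  ext w
  constructor
  · rintro ⟨y, α, hy, hα, hyz, hw⟩
    refine hGc.mem_of_tendsto hw ?_
    filter_upwards [hyz.eventually hΩ] with k hk
    exact hG _ (hα k) _ (hk.1 (hy k))
  · intro hw
    exact mem_tangentCone_of_eventually_add_smul_mem
      (eventually_add_smul_mem_of_eventually_iff hG hΩ hw)

theorem IsPolyhedron.convex {S : Set H} (hS : IsPolyhedron S) : Convex ℝ S := by
  obtain ⟨k, a, b, rfl⟩ := hS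
  simp only [ofPred_forall]
  exact convex_iInter fun i => convex_halfSpace_le (innerₛₗ ℝ (a i)).isLinear (b i)

end Cones

/-! ### Finite generation of polyhedral cones and stability of exposed faces. -/

section Generators

variable {H : Type*} [NormedAddCommGroup H] [InnerProductSpace ℝ H]

/-- Makes the whole space a finitely generated cone, the case of no constraints in
`exists_generators`. -/
theorem finite_nnreal_real : Module.Finite ℝ≥0 ℝ := by
  classical
  refine ⟨⟨{1, -1}, ?_⟩⟩
  rw [eq_top_iff]
  intro x _
  have h1 : (1 : ℝ) ∈ Submodule.span ℝ≥0 (({1, -1} : Finset ℝ) : Set ℝ) :=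
    Submodule.subset_span (by simp)
  have h2 : (-1 : ℝ) ∈ Submodule.span ℝ≥0 (({1, -1} : Finset ℝ) : Set ℝ) :=
    Submodule.subset_span (by simp)
  rcases le_total 0 x with hx | hx
  · simpa [NNReal.smul_def, hx] using Submodule.smul_mem _ x.toNNReal h1
  · simpa [NNReal.smul_def, hx] using Submodule.smul_mem _ (-x).toNNReal h2

theorem smul_mem_of_nonneg (C : Submodule ℝ≥0 H) {t : ℝ} (ht : 0 ≤ t) {x : H} (hx : x ∈ C) :
    t • x ∈ C := by
  simpa [NNReal.smul_def, ht] using C.smul_mem t.toNNReal hx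

/-- The Fourier-Motzkin step: a finitely generated cone cut by a half-space is finitely
generated. -/
theorem exists_span_eq_inter_halfSpace (S : Finset H) (a : H) :
    ∃ S' : Finset H, ∀ q, q ∈ Submodule.span ℝ≥0 (S' : Set H) ↔
      q ∈ Submodule.span ℝ≥0 (S : Set H) ∧ inner ℝ a q ≤ 0 := by
  classical
  set f : H → ℝ := fun g => inner ℝ a g with hf
  set P := S.filter fun g => 0 < f g with hP
  set N := S.filter fun g => ¬ 0 < f g with hN
  -- Each positive generator is combined with each nonpositive one so that the result lies on the
  -- hyperplane `inner ℝ a q = 0`.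
  set S' := N ∪ Finset.image₂ (fun g h => f g • h - f h • g) P N with hS'
  have hfP : ∀ g ∈ P, 0 < f g := fun g hg => (Finset.mem_filter.1 hg).2
  have hfN : ∀ g ∈ N, f g ≤ 0 := fun g hg => not_lt.1 (Finset.mem_filter.1 hg).2
  refine ⟨S', fun q => ⟨fun hq => ?_, ?_⟩⟩
  · induction hq using Submodule.span_induction with
    | zero => simp
    | add x y _ _ hx hy =>
      exact ⟨add_mem hx.1 hy.1, by rw [inner_add_right]; linarith [hx.2, hy.2]⟩
    | smul t x _ hx =>
      refine ⟨Submodule.smul_mem _ _ hx.1, ?_⟩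
      rw [NNReal.smul_def, inner_smul_right]
      exact mul_nonpos_of_nonneg_of_nonpos t.2 hx.2
    | mem x hx =>
      rcases Finset.mem_union.1 (Finset.mem_coe.1 hx) with hx | hx
      · exact ⟨Submodule.subset_span (Finset.mem_filter.1 hx).1, hfN x hx⟩
      · obtain ⟨g, hg, h, hh, rfl⟩ := Finset.mem_image₂.1 hx
        constructor
        · rw [sub_eq_add_neg, ← neg_smul]
          exact add_mem
            (smul_mem_of_nonneg _ (hfP g hg).le
              (Submodule.subset_span (Finset.mem_filter.1 hh).1))
            (smul_mem_of_nonneg _ (neg_nonneg.2 (hfN h hh))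
              (Submodule.subset_span (Finset.mem_filter.1 hg).1))
        · rw [inner_sub_right, inner_smul_right, inner_smul_right]
          exact (sub_eq_zero.2 (mul_comm (f g) (f h))).le
  · rintro ⟨hq, haq⟩
    obtain ⟨l, -, rfl⟩ := Submodule.mem_span_finset.1 hq
    set C := Submodule.span ℝ≥0 (S' : Set H) with hC
    have hNC : ∀ h ∈ N, h ∈ C := fun h hh =>
      Submodule.subset_span (Finset.mem_coe.2 (Finset.mem_union_left _ hh))
    have hPC : ∀ g ∈ P, ∀ h ∈ N, f g • h - f h • g ∈ C := fun g hg h hh =>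
      Submodule.subset_span
        (Finset.mem_coe.2 (Finset.mem_union_right _ (Finset.mem_image₂_of_mem hg hh)))
    have hsplit : ∑ g ∈ S, l g • g = ∑ g ∈ P, (l g : ℝ) • g + ∑ g ∈ N, (l g : ℝ) • g :=
      (Finset.sum_filter_add_sum_filter_not S (fun g => 0 < f g) fun g => (l g : ℝ) • g).symm
    set A := ∑ g ∈ P, (l g : ℝ) * f g with hA
    set B := -∑ g ∈ N, (l g : ℝ) * f g with hB
    have hAB : A ≤ B := by
      rw [hsplit, inner_add_right, inner_sum, inner_sum] at haq
      simp only [inner_smul_right] at haq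
      linarith
    have hA0 : 0 ≤ A := Finset.sum_nonneg fun g hg => mul_nonneg (l g).2 (hfP g hg).le
    have hsumN : ∑ g ∈ N, (l g : ℝ) • g ∈ C :=
      sum_mem fun g hg => smul_mem_of_nonneg _ (l g).2 (hNC g hg)
    rw [hsplit]
    rcases hA0.eq_or_lt with hA0 | hA0
    · have hl : ∀ g ∈ P, (l g : ℝ) = 0 := fun g hg => by
        have := (Finset.sum_eq_zero_iff_of_nonneg
          fun g hg => mul_nonneg (l g).2 (hfP g hg).le).1 hA0.symm g hg
        exact (mul_eq_zero.1 this).resolve_right (hfP g hg).ne'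
      rw [Finset.sum_eq_zero fun g hg => by rw [hl g hg, zero_smul], zero_add]
      exact hsumN
    · have hB0 : 0 < B := hA0.trans_le hAB
      have hcross : ∑ g ∈ P, ∑ h ∈ N, ((l g : ℝ) * l h) • (f g • h - f h • g)
          = A • ∑ h ∈ N, (l h : ℝ) • h + B • ∑ g ∈ P, (l g : ℝ) • g := by
        simp only [smul_sub, Finset.sum_sub_distrib]
        rw [sub_eq_add_neg]
        congr 1
        · rw [hA, Finset.sum_smul]
          refine Finset.sum_congr rfl fun g _ => ?_
          rw [Finset.smul_sum]
          refine Finset.sum_congr rfl fun h _ => ?_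
          simp only [smul_smul]
          congr 1; ring
        · rw [Finset.smul_sum, ← Finset.sum_neg_distrib]
          refine Finset.sum_congr rfl fun g _ => ?_
          rw [hB, neg_smul, Finset.sum_smul]
          congr 1
          refine Finset.sum_congr rfl fun h _ => ?_
          simp only [smul_smul]
          congr 1; ring
      -- The double sum absorbs `B` times the positive part but only `A` times the other; the
      -- remaining weight `B - A` is nonnegative by the half-space inequality.
      have hmem : B • (∑ g ∈ P, (l g : ℝ) • g + ∑ g ∈ N, (l g : ℝ) • g) ∈ C := by
        have : B • (∑ g ∈ P, (l g : ℝ) • g + ∑ g ∈ N, (l g : ℝ) • g)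
            = ∑ g ∈ P, ∑ h ∈ N, ((l g : ℝ) * l h) • (f g • h - f h • g)
              + (B - A) • ∑ h ∈ N, (l h : ℝ) • h := by
          rw [hcross]; module
        rw [this]
        exact add_mem (sum_mem fun g hg => sum_mem fun h hh =>
          smul_mem_of_nonneg _ (mul_nonneg (l g).2 (l h).2) (hPC g hg h hh))
          (smul_mem_of_nonneg _ (sub_nonneg.2 hAB) hsumN)
      simpa [smul_smul, inv_mul_cancel₀ hB0.ne'] using
        smul_mem_of_nonneg C (inv_pos.2 hB0).le hmem

/-- Polyhedral cones are finitely generated (Minkowski-Weyl). -/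
theorem exists_generators [FiniteDimensional ℝ H] {ι : Type*} (a : ι → H) (s : Finset ι) :
    ∃ S : Finset H, ∀ q, q ∈ Submodule.span ℝ≥0 (S : Set H) ↔
      ∀ i ∈ s, inner ℝ (a i) q ≤ 0 := by
  classical
  induction s using Finset.induction_on with
  | empty =>
    have := finite_nnreal_real
    have : Module.Finite ℝ≥0 H := Module.Finite.trans ℝ H
    obtain ⟨S, hS⟩ := this.fg_top
    exact ⟨S, fun q => by simp [hS]⟩
  | insert i s _ ih =>
    obtain ⟨S, hS⟩ := ih
    obtain ⟨S', hS'⟩ := exists_span_eq_inter_halfSpace S (a i)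
    exact ⟨S', fun q => by rw [hS', hS, Finset.forall_mem_insert, and_comm]⟩

theorem inner_nonpos_of_mem_span {S : Set H} {c q : H} (hc : ∀ g ∈ S, inner ℝ c g ≤ 0)
    (hq : q ∈ Submodule.span ℝ≥0 S) : inner ℝ c q ≤ 0 := by
  induction hq using Submodule.span_induction with
  | zero => simp
  | add x y _ _ hx hy => rw [inner_add_right]; linarith
  | smul t x _ hx =>
    rw [NNReal.smul_def, inner_smul_right]
    exact mul_nonpos_of_nonneg_of_nonpos t.2 hx
  | mem x hx => exact hc x hx

/-- Near a point `c` of the polar of a polyhedral cone `T`, membership in the polar is decided on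
the face of `T` exposed by `c`, and the faces exposed by nearby polar vectors are contained in
that face. -/
theorem eventually_polar_polyhedralCone [FiniteDimensional ℝ H] {ι : Type*} (a : ι → H)
    (s : Finset ι) {T : Set H} (hT : T = {q | ∀ i ∈ s, inner ℝ (a i) q ≤ 0}) {c : H}
    (hc : ∀ q ∈ T, inner ℝ c q ≤ 0) :
    ∀ᶠ c' in 𝓝 c,
      ((∀ q ∈ T, inner ℝ c q = 0 → inner ℝ c' q ≤ 0) → ∀ q ∈ T, inner ℝ c' q ≤ 0) ∧
      ((∀ q ∈ T, inner ℝ c' q ≤ 0) → ∀ q ∈ T, inner ℝ c' q = 0 → inner ℝ c q = 0) := by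
  obtain ⟨S, hS⟩ := exists_generators a s
  have hST : ∀ q, q ∈ T ↔ q ∈ Submodule.span ℝ≥0 (S : Set H) := fun q => by rw [hS, hT]; rfl
  have hgT : ∀ g ∈ S, g ∈ T := fun g hg => (hST g).2 (Submodule.subset_span hg)
  -- Finitely many strict inequalities persist near `c`: this is where finite generation is needed.
  have hev : ∀ᶠ c' in 𝓝 c, ∀ g ∈ S, inner ℝ c g < 0 → inner ℝ c' g < 0 := by
    rw [S.eventually_all]
    intro g _
    by_cases hg : inner ℝ c g < 0
    · have : Continuous fun c' : H => inner ℝ c' g := by fun_prop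
      filter_upwards [this.continuousAt.eventually_lt continuousAt_const hg] with c' h _ using h
    · exact Eventually.of_forall fun _ h => absurd h hg
  filter_upwards [hev] with c' hc'
  constructor
  · intro h q hq
    refine inner_nonpos_of_mem_span (fun g hg => ?_) ((hST q).1 hq)
    rcases (hc g (hgT g hg)).lt_or_eq with h0 | h0
    · exact (hc' g hg h0).le
    · exact h g (hgT g hg) h0
  · intro h q hq hq0
    obtain ⟨l, -, rfl⟩ := Submodule.mem_span_finset.1 ((hST q).1 hq)
    simp only [NNReal.smul_def, inner_sum, inner_smul_right] at hq0 ⊢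
    have hz := (Finset.sum_eq_zero_iff_of_nonpos fun g hg =>
      mul_nonpos_of_nonneg_of_nonpos (l g).2 (h g (hgT g hg))).1 hq0
    refine Finset.sum_eq_zero fun g hg => ?_
    rcases mul_eq_zero.1 (hz g hg) with h0 | h0
    · exact mul_eq_zero_of_left h0 _
    · rcases (hc g (hgT g hg)).lt_or_eq with h1 | h1
      · exact absurd h0 (hc' g hg h1).ne
      · rw [h1, mul_zero]

end Generators

end VarAnalysis

namespace VarAnalysis

/-! ### The cone of active constraints as a local model of a polyhedron. -/

section ActiveCone

variable {H : Type*} [NormedAddCommGroup H] [InnerProductSpace ℝ H] {ι : Type*} {a : ι → H}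
  {b : ι → ℝ} {p : H}

/-- The cone cut out by the constraints `⟪a i, ·⟫ ≤ b i` that are active at `p`. -/
def activeCone (a : ι → H) (b : ι → ℝ) (p : H) : Set H :=
  {q | ∀ i, inner ℝ (a i) p = b i → inner ℝ (a i) q ≤ 0}

theorem isClosed_activeCone : IsClosed (activeCone a b p) := by
  simp only [activeCone, ofPred_forall]
  exact isClosed_iInter fun i => isClosed_iInter fun _ =>
    isClosed_le (by fun_prop) continuous_const

theorem smul_mem_activeCone {t : ℝ} (ht : 0 ≤ t) {q : H} (hq : q ∈ activeCone a b p) :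
    t • q ∈ activeCone a b p := fun i hi => by
  rw [inner_smul_right]
  exact mul_nonpos_of_nonneg_of_nonpos ht (hq i hi)

theorem mem_activeCone_of_smul_mem {t : ℝ} (ht : 0 < t) {q : H}
    (hq : t • q ∈ activeCone a b p) : q ∈ activeCone a b p := by
  simpa [smul_smul, inv_mul_cancel₀ ht.ne'] using smul_mem_activeCone (inv_pos.2 ht).le hq

theorem sub_mem_activeCone {x : H} (hx : ∀ i, inner ℝ (a i) x ≤ b i) :
    x - p ∈ activeCone a b p := fun i hi => by
  rw [inner_sub_right, hi]
  linarith [hx i]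

/-- The points satisfying strictly the constraints inactive at `p` form a neighbourhood of
`p`. -/
theorem eventually_inactive [Finite ι] (hp : ∀ i, inner ℝ (a i) p ≤ b i) :
    ∀ᶠ x in 𝓝 p, ∀ i, inner ℝ (a i) p ≠ b i → inner ℝ (a i) x < b i := by
  rw [eventually_all]
  intro i
  by_cases hi : inner ℝ (a i) p = b i
  · exact Eventually.of_forall fun _ h => absurd hi h
  · have : Continuous fun x : H => inner ℝ (a i) x := by fun_prop
    filter_upwards [this.continuousAt.eventually_lt continuousAt_const
      (lt_of_le_of_ne (hp i) hi)] with x hx _ using hx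

theorem eventually_mem_of_sub_mem_activeCone [Finite ι] (hp : ∀ i, inner ℝ (a i) p ≤ b i) :
    ∀ᶠ x in 𝓝 p, x - p ∈ activeCone a b p → ∀ i, inner ℝ (a i) x ≤ b i := by
  filter_upwards [eventually_inactive hp] with x hx hxT i
  by_cases hi : inner ℝ (a i) p = b i
  · have := hxT i hi
    rw [inner_sub_right] at this
    linarith
  · exact (hx i hi).le

/-- A step along `q` cannot increase the constraints active at `p`, and the others stay slack near
`p`; so one neighbourhood of base points `x` serves every `q`. -/
theorem eventually_forall_activeCone_add_smul_mem [Finite ι]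
    (hp : ∀ i, inner ℝ (a i) p ≤ b i) :
    ∀ᶠ x in 𝓝 p, (∀ i, inner ℝ (a i) x ≤ b i) → ∀ q ∈ activeCone a b p,
      ∀ᶠ t : ℝ in 𝓝[>] 0, ∀ i, inner ℝ (a i) (x + t • q) ≤ b i := by
  filter_upwards [(eventually_inactive hp).eventually_nhds] with x hx hxP q hq
  filter_upwards [(tendsto_add_smul_nhdsGT_zero x q).eventually hx, self_mem_nhdsWithin]
    with t ht ht0 i
  by_cases hi : inner ℝ (a i) p = b i
  · have := mul_nonpos_of_nonneg_of_nonpos (le_of_lt ht0) (hq i hi)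
    rw [inner_add_right, inner_smul_right]
    linarith [hxP i]
  · exact (ht i hi).le

theorem eventually_add_smul_mem_of_mem_activeCone [Finite ι]
    (hp : ∀ i, inner ℝ (a i) p ≤ b i) {q : H} (hq : q ∈ activeCone a b p) :
    ∀ᶠ t : ℝ in 𝓝[>] 0, ∀ i, inner ℝ (a i) (p + t • q) ≤ b i :=
  (eventually_forall_activeCone_add_smul_mem hp).self_of_nhds hp q hq

end ActiveCone

/-! ### The graph of the normal cone mapping of a cone, and its polar. -/

section NormalGraph

variable {E : Type*} [NormedAddCommGroup E] [InnerProductSpace ℝ E] {K : Set E}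

/-- The graph of the normal cone mapping of a cone `K`. -/
def normalGraph (K : Set E) : Set (WithLp 2 (E × E)) :=
  {u | u.fst ∈ K ∧ (∀ w ∈ K, inner ℝ u.snd w ≤ 0) ∧ inner ℝ u.snd u.fst = 0}

theorem smul_mem_normalGraph (hK : ∀ t : ℝ, 0 ≤ t → ∀ w ∈ K, t • w ∈ K) (t : ℝ) (ht : 0 ≤ t)
    (u : WithLp 2 (E × E)) (hu : u ∈ normalGraph K) : t • u ∈ normalGraph K := by
  refine ⟨hK t ht _ hu.1, fun w hw => ?_, ?_⟩
  · rw [WithLp.smul_snd, inner_smul_left]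
    exact mul_nonpos_of_nonneg_of_nonpos ht (hu.2.1 w hw)
  · rw [WithLp.smul_snd, WithLp.smul_fst, inner_smul_left, inner_smul_right, hu.2.2]
    simp

theorem isClosed_normalGraph (hK : IsClosed K) : IsClosed (normalGraph K) := by
  have h1 : Continuous fun u : WithLp 2 (E × E) => u.fst := WithLp.continuous_fst 2 E E
  have h2 : Continuous fun u : WithLp 2 (E × E) => u.snd := WithLp.continuous_snd 2 E E
  refine (hK.preimage h1).inter (IsClosed.inter ?_ (isClosed_eq (h2.inner h1) continuous_const))
  change IsClosed {u : WithLp 2 (E × E) | ∀ w ∈ K, inner ℝ u.snd w ≤ 0}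
  simp only [ofPred_forall]
  exact isClosed_iInter fun w => isClosed_iInter fun _ =>
    isClosed_le (h2.inner continuous_const) continuous_const

theorem forall_normalGraph_inner_nonpos_iff (h0 : (0 : E) ∈ K)
    (hK : ∀ x, (∀ y, (∀ w ∈ K, inner ℝ y w ≤ 0) → inner ℝ x y ≤ 0) → x ∈ K) {x y : E} :
    (∀ u ∈ normalGraph K, inner ℝ (WithLp.toLp 2 (x, y)) u ≤ 0) ↔
      (∀ w ∈ K, inner ℝ x w ≤ 0) ∧ y ∈ K := by
  constructor
  · intro h
    refine ⟨fun w hw => ?_, hK y fun y' hy' => ?_⟩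
    · simpa [WithLp.prod_inner_apply] using
        h (WithLp.toLp 2 (w, 0)) ⟨hw, fun _ _ => by simp, by simp⟩
    · simpa [WithLp.prod_inner_apply] using
        h (WithLp.toLp 2 (0, y')) ⟨h0, hy', by simp⟩
  · rintro ⟨hx, hy⟩ u hu
    have h1 := hx _ hu.1
    have h2 := hu.2.1 y hy
    rw [real_inner_comm] at h2
    rw [WithLp.prod_inner_apply]
    exact add_nonpos h1 h2

end NormalGraph

/-! ### Subderivative, critical cone and the local form of the graph of the subdifferential. -/

section Epigraph

variable {E : Type*} [NormedAddCommGroup E] [InnerProductSpace ℝ E]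

theorem inner_epi_normal (v : E) (q : WithLp 2 (E × ℝ)) :
    inner ℝ (WithLp.toLp 2 (v, (-1 : ℝ))) q = inner ℝ v q.fst - q.snd := by
  simp [WithLp.prod_inner_apply, sub_eq_add_neg]

theorem mem_subdifferential_iff {θ : E → EReal} (hθ : Convex ℝ (epi θ)) {z v : E} :
    v ∈ subdifferential θ z ↔
      ∃ r : ℝ, θ z = r ∧ ∀ u ∈ epi θ, inner ℝ v (u.fst - z) ≤ u.snd - r := by
  refine exists_congr fun r => and_congr_right fun hr => ?_
  rw [mem_limitingNormalCone_iff_of_convex hθ (show θ z ≤ r from hr.le)]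
  refine forall₂_congr fun u _ => ?_
  rw [inner_epi_normal]
  simp

theorem sub_div_le_coe_iff {x : EReal} {r s t : ℝ} (ht : 0 < t) :
    (x - r) / (t : EReal) ≤ s ↔ x ≤ ((r + t * s : ℝ) : EReal) := by
  rw [EReal.div_le_iff_le_mul (by exact_mod_cast ht) (EReal.coe_ne_top t),
    EReal.sub_le_iff_le_add (by simp) (by simp), EReal.coe_add, EReal.coe_mul, add_comm]

variable {θ : E → EReal} {k : ℕ} {a : Fin k → WithLp 2 (E × ℝ)} {b : Fin k → ℝ} {z v : E} {r : ℝ}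

theorem mem_activeCone_of_le (hP : epi θ = {x | ∀ i, inner ℝ (a i) x ≤ b i}) {t s : ℝ}
    (ht : 0 < t) {u : E} (h : θ (z + t • u) ≤ ((r + t * s : ℝ) : EReal)) :
    WithLp.toLp 2 (u, s) ∈ activeCone a b (WithLp.toLp 2 (z, r)) := by
  have hmem : WithLp.toLp 2 (z + t • u, r + t * s) ∈ epi θ := h
  rw [hP] at hmem
  refine mem_activeCone_of_smul_mem ht ?_
  have := sub_mem_activeCone (p := WithLp.toLp 2 (z, r)) hmem
  convert this using 1
  rw [← WithLp.toLp_sub, ← WithLp.toLp_smul]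
  simp

theorem eventually_le_of_mem_activeCone (hP : epi θ = {x | ∀ i, inner ℝ (a i) x ≤ b i})
    (hr : θ z = r) {w : E} {s : ℝ}
    (h : WithLp.toLp 2 (w, s) ∈ activeCone a b (WithLp.toLp 2 (z, r))) :
    ∀ᶠ t : ℝ in 𝓝[>] 0, θ (z + t • w) ≤ ((r + t * s : ℝ) : EReal) := by
  have hp : WithLp.toLp 2 (z, r) ∈ epi θ := hr.le
  rw [hP] at hp
  filter_upwards [eventually_add_smul_mem_of_mem_activeCone hp h] with t ht
  have : WithLp.toLp 2 (z, r) + t • WithLp.toLp 2 (w, s) ∈ epi θ := by rw [hP]; exact ht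
  exact this

/-- Difference quotients below a level lie in the active cone, which is closed; conversely the ray
in the direction `(w, s)` stays in the epigraph for small `t`. -/
theorem subderivative_le_iff (hP : epi θ = {x | ∀ i, inner ℝ (a i) x ≤ b i}) (hr : θ z = r)
    {w : E} {s : ℝ} : subderivative θ z w ≤ s ↔
      WithLp.toLp 2 (w, s) ∈ activeCone a b (WithLp.toLp 2 (z, r)) := by
  rw [subderivative, hr]
  constructor
  · intro h
    have hε : ∀ ε : ℝ, 0 < ε →
        WithLp.toLp 2 (w, s + ε) ∈ activeCone a b (WithLp.toLp 2 (z, r)) := by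
      intro ε hε
      have hlt := frequently_lt_of_liminf_lt (by isBoundedDefault)
        (h.trans_lt (EReal.coe_lt_coe_iff.2 (lt_add_of_pos_right s hε)))
      have hcont : Continuous fun u : E => WithLp.toLp 2 (u, s + ε) :=
        (WithLp.prod_continuous_toLp 2 E ℝ).comp (by fun_prop)
      refine isClosed_activeCone.mem_of_frequently_of_tendsto ?_
        ((hcont.tendsto w).comp (tendsto_snd (f := 𝓝[>] (0 : ℝ))))
      have hpos : ∀ᶠ y : ℝ × E in 𝓝[>] (0 : ℝ) ×ˢ 𝓝 w, 0 < y.1 :=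
        tendsto_fst.eventually self_mem_nhdsWithin
      refine (hlt.and_eventually hpos).mono fun y hy => ?_
      exact mem_activeCone_of_le hP hy.2 ((sub_div_le_coe_iff hy.2).1 hy.1.le)
    have hcont : Continuous fun ε : ℝ => WithLp.toLp 2 (w, s + ε) :=
      (WithLp.prod_continuous_toLp 2 E ℝ).comp (by fun_prop)
    have hlim := (hcont.tendsto 0).mono_left (nhdsWithin_le_nhds (s := Ioi 0))
    rw [add_zero] at hlim
    exact isClosed_activeCone.mem_of_tendsto hlim
      (eventually_nhdsWithin_of_forall fun ε hε' => hε ε hε')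
  · intro h
    have hlim : Tendsto (fun t : ℝ => (t, w)) (𝓝[>] 0) (𝓝[>] (0 : ℝ) ×ˢ 𝓝 w) :=
      tendsto_id.prodMk tendsto_const_nhds
    refine liminf_le_of_frequently_le (hlim.frequently (Eventually.frequently ?_))
    filter_upwards [eventually_le_of_mem_activeCone hP hr h, self_mem_nhdsWithin] with t ht ht0
    exact (sub_div_le_coe_iff ht0).2 ht

theorem inner_le_subderivative (hP : epi θ = {x | ∀ i, inner ℝ (a i) x ≤ b i}) (hr : θ z = r)
    (hv : ∀ q ∈ activeCone a b (WithLp.toLp 2 (z, r)), inner ℝ v q.fst ≤ q.snd) (w : E) :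
    ((inner ℝ v w : ℝ) : EReal) ≤ subderivative θ z w := by
  by_contra! h
  obtain ⟨s, hs, hsv⟩ := EReal.lt_iff_exists_real_btwn.1 h
  have := hv _ ((subderivative_le_iff hP hr).1 hs.le)
  exact absurd (EReal.coe_lt_coe_iff.1 hsv) (not_lt.2 this)

theorem criticalCone_eq (hP : epi θ = {x | ∀ i, inner ℝ (a i) x ≤ b i}) (hr : θ z = r)
    (hv : ∀ q ∈ activeCone a b (WithLp.toLp 2 (z, r)), inner ℝ v q.fst ≤ q.snd) :
    criticalCone θ z v =
      {w | WithLp.toLp 2 (w, inner ℝ v w) ∈ activeCone a b (WithLp.toLp 2 (z, r))} := by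
  ext w
  constructor
  · rintro ⟨-, h⟩
    exact (subderivative_le_iff hP hr).1 h.ge
  · intro h
    refine ⟨mem_tangentCone_of_eventually_add_smul_mem ?_,
      (inner_le_subderivative hP hr hv w).antisymm ((subderivative_le_iff hP hr).2 h)⟩
    filter_upwards [eventually_le_of_mem_activeCone hP hr h] with t ht
    exact ht.trans_lt (EReal.coe_lt_top _)

theorem mem_criticalCone_iff_inner (hP : epi θ = {x | ∀ i, inner ℝ (a i) x ≤ b i})
    (hr : θ z = r)
    (hv : ∀ q ∈ activeCone a b (WithLp.toLp 2 (z, r)), inner ℝ v q.fst ≤ q.snd) {w : E} :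
    w ∈ criticalCone θ z v ↔ ∀ i, inner ℝ (a i) (WithLp.toLp 2 (z, r)) = b i →
      inner ℝ ((a i).fst + (a i).snd • v) w ≤ 0 := by
  rw [criticalCone_eq hP hr hv]
  refine forall₂_congr fun i _ => ?_
  rw [inner_add_left, inner_smul_left, WithLp.prod_inner_apply]
  simp [mul_comm]

theorem isClosed_criticalCone (hP : epi θ = {x | ∀ i, inner ℝ (a i) x ≤ b i})
    (hr : θ z = r)
    (hv : ∀ q ∈ activeCone a b (WithLp.toLp 2 (z, r)), inner ℝ v q.fst ≤ q.snd) :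
    IsClosed (criticalCone θ z v) := by
  rw [criticalCone_eq hP hr hv]
  exact isClosed_activeCone.preimage
    ((WithLp.prod_continuous_toLp 2 E ℝ).comp (by fun_prop : Continuous fun w => (w, inner ℝ v w)))

theorem smul_mem_criticalCone (hP : epi θ = {x | ∀ i, inner ℝ (a i) x ≤ b i})
    (hr : θ z = r)
    (hv : ∀ q ∈ activeCone a b (WithLp.toLp 2 (z, r)), inner ℝ v q.fst ≤ q.snd)
    (t : ℝ) (ht : 0 ≤ t) (w : E) (hw : w ∈ criticalCone θ z v) :
    t • w ∈ criticalCone θ z v := by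
  rw [mem_criticalCone_iff_inner hP hr hv] at hw ⊢
  intro i hi
  rw [inner_smul_right]
  exact mul_nonpos_of_nonneg_of_nonpos ht (hw i hi)

/-- The bipolar property needs no separation argument here: the vectors defining the cone already
lie in its polar. -/
theorem mem_criticalCone_of_forall_polar (hP : epi θ = {x | ∀ i, inner ℝ (a i) x ≤ b i})
    (hr : θ z = r)
    (hv : ∀ q ∈ activeCone a b (WithLp.toLp 2 (z, r)), inner ℝ v q.fst ≤ q.snd) (x : E)
    (hx : ∀ y, (∀ w ∈ criticalCone θ z v, inner ℝ y w ≤ 0) → inner ℝ x y ≤ 0) :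
    x ∈ criticalCone θ z v := by
  rw [mem_criticalCone_iff_inner hP hr hv]
  intro i hi
  rw [real_inner_comm]
  exact hx _ fun w hw => (mem_criticalCone_iff_inner hP hr hv).1 hw i hi

/-- Near `(z, v)` the graph of `∂θ` is a translate of the graph of the normal cone mapping of the
critical cone. -/
theorem eventually_mem_gph_subdifferential_iff [FiniteDimensional ℝ E]
    (hP : epi θ = {x | ∀ i, inner ℝ (a i) x ≤ b i}) (hr : θ z = r)
    (hconv : Convex ℝ (epi θ))
    (hv : ∀ q ∈ activeCone a b (WithLp.toLp 2 (z, r)), inner ℝ v q.fst ≤ q.snd) :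
    ∀ᶠ u in 𝓝 (WithLp.toLp 2 (z, v)), u ∈ gph (subdifferential θ) ↔
      u - WithLp.toLp 2 (z, v) ∈ normalGraph (criticalCone θ z v) := by
  classical
  set p : WithLp 2 (E × ℝ) := WithLp.toLp 2 (z, r) with hpdef
  have hpe : p ∈ epi θ := hr.le
  have hp : ∀ i, inner ℝ (a i) p ≤ b i := by rw [hP] at hpe; exact hpe
  have hfst : Continuous fun u : WithLp 2 (E × E) => u.fst := WithLp.continuous_fst 2 E E
  have hsnd : Continuous fun u : WithLp 2 (E × E) => u.snd := WithLp.continuous_snd 2 E E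
  have hpolar := eventually_polar_polyhedralCone a
    (Finset.univ.filter fun i => inner ℝ (a i) p = b i) (T := activeCone a b p)
    (by ext q; simp [activeCone]) (c := WithLp.toLp 2 (v, (-1 : ℝ)))
    (fun q hq => by rw [inner_epi_normal]; linarith [hv q hq])
  have hcont1 : Continuous fun u : WithLp 2 (E × E) => WithLp.toLp 2 (u.snd, (-1 : ℝ)) :=
    (WithLp.prod_continuous_toLp 2 E ℝ).comp (hsnd.prodMk continuous_const)
  have hcont2 : Continuous fun u : WithLp 2 (E × E) =>
      WithLp.toLp 2 (u.fst, r + inner ℝ v (u.fst - z)) :=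
    (WithLp.prod_continuous_toLp 2 E ℝ).comp (hfst.prodMk (by fun_prop))
  have hev1 := (hcont1.tendsto (WithLp.toLp 2 (z, v))).eventually hpolar
  have hev2 := (hcont2.tendsto (WithLp.toLp 2 (z, v))).eventually
    (p := fun x => x - p ∈ activeCone a b p → ∀ i, inner ℝ (a i) x ≤ b i)
    (by simpa using eventually_mem_of_sub_mem_activeCone hp)
  -- Closeness of `u.fst` to `z` does not by itself bring `r'` near `r`; the two subgradient
  -- inequalities squeeze `r' - r` between quantities tending to `0`.
  have hev3 : ∀ᶠ u : WithLp 2 (E × E) in 𝓝 (WithLp.toLp 2 (z, v)), ∀ r' : ℝ,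
      inner ℝ v (u.fst - z) ≤ r' - r → r' - r ≤ inner ℝ u.snd (u.fst - z) →
      (∀ i, inner ℝ (a i) (WithLp.toLp 2 (u.fst, r')) ≤ b i) → ∀ q ∈ activeCone a b p,
      ∀ᶠ t : ℝ in 𝓝[>] 0, ∀ i, inner ℝ (a i) (WithLp.toLp 2 (u.fst, r') + t • q) ≤ b i := by
    have h := ((WithLp.prod_continuous_toLp 2 E ℝ).tendsto (z, r)).eventually
      (eventually_forall_activeCone_add_smul_mem hp)
    rw [nhds_prod_eq] at h
    obtain ⟨S, hS, R, hR, hSR⟩ := eventually_prod_iff.1 h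
    obtain ⟨δ, hδ, hδR⟩ := Metric.eventually_nhds_iff.1 hR
    have c1 : Continuous fun u : WithLp 2 (E × E) => inner ℝ v (u.fst - z) := by fun_prop
    have c2 : Continuous fun u : WithLp 2 (E × E) => inner ℝ u.snd (u.fst - z) := by fun_prop
    have e1 : ∀ᶠ u : WithLp 2 (E × E) in 𝓝 (WithLp.toLp 2 (z, v)),
        -δ < inner ℝ v (u.fst - z) :=
      continuousAt_const.eventually_lt c1.continuousAt (by simpa using hδ)
    have e2 : ∀ᶠ u : WithLp 2 (E × E) in 𝓝 (WithLp.toLp 2 (z, v)),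
        inner ℝ u.snd (u.fst - z) < δ :=
      c2.continuousAt.eventually_lt continuousAt_const (by simpa using hδ)
    filter_upwards [(hfst.tendsto (WithLp.toLp 2 (z, v))).eventually hS, e1, e2]
      with u hu h1 h2 r' h3 h4
    refine hSR hu (hδR ?_)
    rw [Real.dist_eq, abs_lt]
    constructor <;> linarith
  filter_upwards [hev1, hev2, hev3] with u ⟨hu1, hu1'⟩ hu2 hu3
  have hK := criticalCone_eq hP hr hv
  simp only [inner_epi_normal] at hu1 hu1'
  change u.snd ∈ subdifferential θ u.fst ↔ _
  rw [mem_subdifferential_iff hconv]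
  simp only [normalGraph, mem_ofPred_eq, WithLp.sub_fst, WithLp.sub_snd, WithLp.toLp_fst,
    WithLp.toLp_snd]
  have hepi : ∀ x ∈ epi θ, x - p ∈ activeCone a b p := fun x hx => by
    rw [hP] at hx; exact sub_mem_activeCone hx
  constructor
  · rintro ⟨r', hr', hu⟩
    have hp'e : WithLp.toLp 2 (u.fst, r') ∈ epi θ := hr'.le
    have hxT := hepi _ hp'e
    have hle1 : inner ℝ v (u.fst - z) ≤ r' - r := hv _ hxT
    have hle2 : r' - r ≤ inner ℝ u.snd (u.fst - z) := by
      have : inner ℝ u.snd (z - u.fst) ≤ r - r' := hu p hpe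
      rw [← neg_sub u.fst z, inner_neg_right] at this
      linarith
    have hsub : ∀ q ∈ activeCone a b p, inner ℝ u.snd q.fst - q.snd ≤ 0 := by
      intro q hq
      obtain ⟨t, ht, ht0⟩ := ((hu3 r' hle1 hle2 (by rw [hP] at hp'e; exact hp'e) q hq).and
        self_mem_nhdsWithin).exists
      have ht0 : 0 < t := ht0
      have hmem : WithLp.toLp 2 (u.fst, r') + t • q ∈ epi θ := by rw [hP]; exact ht
      have h := hu _ hmem
      simp only [WithLp.add_fst, WithLp.smul_fst, WithLp.add_snd, WithLp.smul_snd,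
        WithLp.toLp_fst, WithLp.toLp_snd, add_sub_cancel_left, inner_smul_right,
        smul_eq_mul] at h
      exact sub_nonpos.2 (le_of_mul_le_mul_left h ht0)
    have heq : inner ℝ u.snd (u.fst - z) = r' - r :=
      le_antisymm (sub_nonpos.1 (hsub _ hxT)) hle2
    -- The displacement lies in the face exposed by `(u.snd, -1)`, hence in the one exposed by `(v,
    -- -1)`.
    have heqv : inner ℝ v (u.fst - z) = r' - r :=
      sub_eq_zero.1 (hu1' hsub _ hxT (sub_eq_zero.2 heq))
    refine ⟨?_, fun w hw => ?_, ?_⟩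
    · rw [hK, mem_ofPred_eq, heqv]
      exact hxT
    · rw [hK] at hw
      have : inner ℝ u.snd w - inner ℝ v w ≤ 0 := hsub _ hw
      rwa [inner_sub_left]
    · rw [inner_sub_left, heq, heqv, sub_self]
  · rintro ⟨hx, hy, hxy⟩
    rw [hK, mem_ofPred_eq] at hx
    rw [inner_sub_left, sub_eq_zero] at hxy
    have hp'e : WithLp.toLp 2 (u.fst, r + inner ℝ v (u.fst - z)) ∈ epi θ := by
      rw [hP]
      refine hu2 ?_
      convert hx using 1
      rw [hpdef, ← WithLp.toLp_sub]
      simp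
    have hsub : ∀ q ∈ activeCone a b p, inner ℝ u.snd q.fst - q.snd ≤ 0 := by
      -- Only the face exposed by `(v, -1)` needs testing; its points project into the critical
      -- cone.
      refine hu1 fun q hq hq0 => ?_
      have hqK : q.fst ∈ criticalCone θ z v := by
        rw [hK, mem_ofPred_eq, sub_eq_zero.1 hq0]
        exact hq
      have := hy _ hqK
      rw [inner_sub_left] at this
      linarith
    have hval : θ u.fst = ((r + inner ℝ v (u.fst - z) : ℝ) : EReal) := by
      refine le_antisymm hp'e ?_
      by_contra! hlt
      obtain ⟨s, hs, hsv⟩ := EReal.lt_iff_exists_real_btwn.1 hlt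
      have h1 : inner ℝ v (u.fst - z) ≤ s - r :=
        hv _ (hepi (WithLp.toLp 2 (u.fst, s)) hs.le)
      have h2 := EReal.coe_lt_coe_iff.1 hsv
      linarith
    refine ⟨_, hval, fun x hx => ?_⟩
    have h1 : inner ℝ u.snd (x.fst - z) - (x.snd - r) ≤ 0 := hsub _ (hepi x hx)
    rw [← sub_sub_sub_cancel_right x.fst u.fst z, inner_sub_right, hxy]
    linarith

end Epigraph

end VarAnalysis

/-! ### The main theorem, read off from the graph of the normal cone mapping of `K`. -/

theorem theorem3p7 (m : ℕ) (θ : EuclideanSpace ℝ (Fin m) → EReal)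
    (hθ : VarAnalysis.IsCPWL θ) (z v : EuclideanSpace ℝ (Fin m))
    (hv : WithLp.toLp 2 (z, v) ∈ VarAnalysis.gph (VarAnalysis.subdifferential θ)) :
    VarAnalysis.svDom
        (VarAnalysis.graphicalDerivative (VarAnalysis.subdifferential θ) z v)
      = VarAnalysis.criticalCone θ z v ∧
    -VarAnalysis.svDom
        (VarAnalysis.regularCoderivative (VarAnalysis.subdifferential θ) z v)
      = VarAnalysis.criticalCone θ z v ∧
    ∀ u ∈ VarAnalysis.criticalCone θ z v,
      VarAnalysis.graphicalDerivative (VarAnalysis.subdifferential θ) z v u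
        = {w | w ∈ VarAnalysis.regularCoderivative (VarAnalysis.subdifferential θ) z v (-u) ∧
            inner ℝ w u = 0} ∧
      VarAnalysis.graphicalDerivative (VarAnalysis.subdifferential θ) z v u
        = VarAnalysis.argminOn (fun w => -inner ℝ w u)
            (VarAnalysis.regularCoderivative (VarAnalysis.subdifferential θ) z v (-u)) := by
  open VarAnalysis in
  obtain ⟨k, a, b, hP⟩ := hθ.isPolyhedron_epi
  have hconv := hθ.isPolyhedron_epi.convex
  obtain ⟨r, hr, hsub⟩ := (mem_subdifferential_iff hconv).1 hv
  simp only [WithLp.toLp_fst, WithLp.toLp_snd] at hr hsub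
  have hvT : ∀ q ∈ activeCone a b (WithLp.toLp 2 (z, r)), inner ℝ v q.fst ≤ q.snd := by
    intro q hq
    obtain ⟨t, ht, ht0⟩ := ((eventually_le_of_mem_activeCone hP hr (w := q.fst) (s := q.snd)
      hq).and self_mem_nhdsWithin).exists
    have ht0 : 0 < t := ht0
    have h := hsub (WithLp.toLp 2 (z + t • q.fst, r + t * q.snd)) ht
    simp only [WithLp.toLp_fst, WithLp.toLp_snd, add_sub_cancel_left, inner_smul_right] at h
    exact le_of_mul_le_mul_left h ht0
  have hev := eventually_mem_gph_subdifferential_iff hP hr hconv hvT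
  have hcl := isClosed_criticalCone hP hr hvT
  have hsm := smul_mem_criticalCone hP hr hvT
  have hbip := mem_criticalCone_of_forall_polar hP hr hvT
  set K := criticalCone θ z v
  have h0 : (0 : EuclideanSpace ℝ (Fin m)) ∈ K := hbip 0 fun y _ => by simp
  have hD : ∀ u w, w ∈ graphicalDerivative (subdifferential θ) z v u ↔
      u ∈ K ∧ (∀ x ∈ K, inner ℝ w x ≤ 0) ∧ inner ℝ w u = 0 := fun u w => by
    rw [graphicalDerivative, mem_ofPred_eq, tangentCone_eq_of_eventually_iff
      (smul_mem_normalGraph hsm) (isClosed_normalGraph hcl) hev]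
    rfl
  have hC : ∀ u w, w ∈ regularCoderivative (subdifferential θ) z v (-u) ↔
      (∀ x ∈ K, inner ℝ w x ≤ 0) ∧ u ∈ K := fun u w => by
    rw [regularCoderivative, mem_ofPred_eq, neg_neg, mem_regularNormalCone_iff_of_eventually_iff
      (smul_mem_normalGraph hsm) hev, forall_normalGraph_inner_nonpos_iff h0 hbip]
  refine ⟨?_, ?_, fun u hu => ⟨?_, ?_⟩⟩
  · ext u
    exact ⟨fun ⟨w, hw⟩ => ((hD u w).1 hw).1,
      fun hu => ⟨0, (hD u 0).2 ⟨hu, fun x _ => by simp, by simp⟩⟩⟩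
  · ext u
    exact ⟨fun ⟨w, hw⟩ => ((hC u w).1 hw).2, fun hu => ⟨0, (hC u 0).2 ⟨fun x _ => by simp, hu⟩⟩⟩
  · ext w
    rw [hD, mem_ofPred_eq, hC]
    tauto
  · ext w
    rw [hD, argminOn, mem_ofPred_eq, hC, isMinOn_iff]
    constructor
    · rintro ⟨-, hw, hwu⟩
      refine ⟨⟨hw, hu⟩, fun w' hw' => ?_⟩
      have := ((hC u w').1 hw').1 u hu
      linarith
    · rintro ⟨⟨hw, -⟩, hmin⟩
      -- Comparison with the feasible point `0` forces `inner ℝ w u ≥ 0`; polarity gives the reverse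
      -- inequality.
      have h1 := hmin 0 ((hC u 0).2 ⟨fun x _ => by simp, hu⟩)
      rw [inner_zero_left] at h1
      exact ⟨hu, hw, le_antisymm (hw u hu) (by linarith)⟩
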